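/- **Conventions.** Let $\ell$ be a field. A *graph* $E$ consists of sets $E^0$ (vertices) and $E^1$ (edges) and maps $s,r:E^1\to E^0$ (source and range); $E$ is *countable* (resp. *finite*) if both $E^0$ and $E^1$ are. The *Leavitt path algebra* $L(E)$ is the associative, not necessarily unital, $\ell$-algebra with generators $v$ $(v\in E^0)$ and $e,e^*$ $(e\in E^1)$ and relations $vw=\delta_{v,w}v$; $s(e)e=e=e\,r(e)$; $r(e)e^*=e^*=e^*s(e)$; $e^*f=\delta_{e,f}r(e)$; and $v=\sum_{s(e)=v}ee^*$ for each vertex $v$ that emits at least one and only finitely many edges. For idempotents $p,q$ of a ring $A$ write $p\sim q$ if there are $x\in pAq$, $y\in qAp$ with $xy=p$, $yx=q$. An idempotent $p$ is *infinite* if $p=q+r$ with $q,r$ orthogonal idempotents, $p\sim q$ and $r\neq 0$. A ring $A$ is *purely infinite simple* if it is simple and for every $0\ne a\in A$ there are $b,c\in A$ such that $bac$ is an infinite idempotent. For a unital ring $R$, $M_\infty R=\bigcup_n M_nR$ is the ring of matrices indexed by $\mathbb N\times\mathbb N$ with finitely many nonzero entries, $\mathcal V(R)$ is the monoid of $\sim$-classes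 of idempotents of $M_\infty R$ under direct sum, $K_0(R)$ is its group completion, and $[1_R]\in K_0(R)$ is the class of $1_R$ placed in the upper left corner. **Statement.** Let $E$ be a graph such that $L(E)$ is simple and let $R$ be a unital purely infinite simple $\ell$-algebra. 1. If $E$ is countable, then $L(E)$ embeds as a subalgebra of $M_\infty R$, i.e. there is an injective homomorphism of $\ell$-algebras $L(E)\to M_\infty R$. 2. If $E^0$ is finite, $E^1$ is countable and $[1_R]=0$ in $K_0(R)$, then $L(E)$ is unital and embeds as a unital subalgebra of $R$, i.e. there is an injective homomorphism of $\ell$-algebras $L(E)\to R$ that maps the identity of $L(E)$ to $1_R$. 3. If $E$ is finite, then $L(E)$ embeds as a subalgebra of $R$, i.e. there is an injective, not necessarily unital, homomorphism of $\ell$-algebras $L(E)\to R$. -/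

import Mathlib

universe u v w x

/-! ### Directed graphs and Leavitt path algebras -/

set_option linter.checkUnivs false in
/-- A directed graph: a type of vertices, a type of edges, and source and range maps.
Loops and multiple edges are allowed, and there is no finiteness condition. -/
structure DirectedGraph where
  /-- the vertices -/
  Vertex : Type u
  /-- the edges -/
  Edge : Type v
  /-- the source of an edge -/
  source : Edge → Vertex
  /-- the range of an edge -/
  range : Edge → Vertex

namespace DirectedGraph

/-- A graph is countable if it has countably many vertices and countably many edges. -/
def IsCountable (E : DirectedGraph.{u, v}) : Prop := Countable E.Vertex ∧ Countable E.Edge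

/-- A graph is finite if it has finitely many vertices and finitely many edges. -/
def IsFinite (E : DirectedGraph.{u, v}) : Prop := Finite E.Vertex ∧ Finite E.Edge

end DirectedGraph

namespace Leavitt

/-- Generators of the Leavitt path algebra: the vertices `v`, the edges `e`, and the ghost edges
`e*`. -/
inductive Gen (E : DirectedGraph.{u, v}) : Type (max u v)
  | vertex (a : E.Vertex) : Gen E
  | edge (e : E.Edge) : Gen E
  | ghost (e : E.Edge) : Gen E

section
variable (l : Type w) [Field l] (E : DirectedGraph.{u, v})

/-- The vertex generator in the free algebra. -/
abbrev fv (a : E.Vertex) : FreeAlgebra l (Gen E) := FreeAlgebra.ι l (Gen.vertex a)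

/-- The edge generator in the free algebra. -/
abbrev fe (e : E.Edge) : FreeAlgebra l (Gen E) := FreeAlgebra.ι l (Gen.edge e)

/-- The ghost edge generator in the free algebra. -/
abbrev fg (e : E.Edge) : FreeAlgebra l (Gen E) := FreeAlgebra.ι l (Gen.ghost e)

/-- The defining relations of the Leavitt path algebra. The last one is imposed exactly at the
regular vertices `a`, those that emit at least one and only finitely many edges: the finite set
`S` is then the set of all edges with source `a`. -/
inductive Rel : FreeAlgebra l (Gen E) → FreeAlgebra l (Gen E) → Prop
  | vertex_mul_self (a : E.Vertex) : Rel (fv l E a * fv l E a) (fv l E a)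
  | vertex_mul_of_ne (a b : E.Vertex) (h : a ≠ b) : Rel (fv l E a * fv l E b) 0
  | source_mul_edge (e : E.Edge) : Rel (fv l E (E.source e) * fe l E e) (fe l E e)
  | edge_mul_range (e : E.Edge) : Rel (fe l E e * fv l E (E.range e)) (fe l E e)
  | range_mul_ghost (e : E.Edge) : Rel (fv l E (E.range e) * fg l E e) (fg l E e)
  | ghost_mul_source (e : E.Edge) : Rel (fg l E e * fv l E (E.source e)) (fg l E e)
  | ghost_mul_edge_self (e : E.Edge) : Rel (fg l E e * fe l E e) (fv l E (E.range e))
  | ghost_mul_edge_of_ne (e f : E.Edge) (h : e ≠ f) : Rel (fg l E e * fe l E f) 0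
  | regular (a : E.Vertex) (S : Finset E.Edge) (hS : ∀ e, e ∈ S ↔ E.source e = a)
      (hne : S.Nonempty) : Rel (fv l E a) (∑ e ∈ S, fe l E e * fg l E e)

/-- The unital algebra with the generators and relations of the Leavitt path algebra. As the
relations do not involve the unit, it is obtained from the Leavitt path algebra by formally
adjoining a unit. -/
abbrev UnitalEnvelope : Type (max u v w) := RingQuot (Rel l E)

/-- The image of a generator in `UnitalEnvelope`. -/
noncomputable def gen (g : Gen E) : UnitalEnvelope l E :=
  RingQuot.mkAlgHom l (Rel l E) (FreeAlgebra.ι l g)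

/-- The Leavitt path algebra `L(E)` over the field `l`: the (in general non-unital) associative
algebra with generators `Gen E` and relations `Rel l E`, realized as the non-unital subalgebra of
`UnitalEnvelope l E` that the generators generate. -/
abbrev LeavittPathAlgebra : Type (max u v w) :=
  ↥(NonUnitalAlgebra.adjoin l (Set.range (gen l E)))

end

/-! ### Idempotents -/

section
variable {R : Type x} [NonUnitalRing R]

/-- Murray-von Neumann equivalence of the idempotents `p` and `q`: there are `x ∈ pRq` and
`y ∈ qRp` with `xy = p` and `yx = q`. -/
def MvN (p q : R) : Prop :=
  ∃ x y : R, p * x * q = x ∧ q * y * p = y ∧ x * y = p ∧ y * x = q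

/-- An infinite idempotent: `p = q + r` with `q` and `r` orthogonal idempotents, `p ∼ q` and
`r ≠ 0`. -/
def IsInfiniteIdempotent (p : R) : Prop :=
  IsIdempotentElem p ∧ ∃ q r : R, IsIdempotentElem q ∧ IsIdempotentElem r ∧
    q * r = 0 ∧ r * q = 0 ∧ p = q + r ∧ MvN p q ∧ r ≠ 0

/-- A ring is purely infinite simple if it is simple and for every `a ≠ 0` there are `s`, `t`
such that `s a t` is an infinite idempotent. -/
def IsPurelyInfiniteSimple (R : Type x) [NonUnitalRing R] : Prop :=
  IsSimpleRing R ∧ ∀ a : R, a ≠ 0 → ∃ s t : R, IsInfiniteIdempotent (s * a * t)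

theorem MvN.refl {p : R} (hp : IsIdempotentElem p) : MvN p p :=
  ⟨p, p, by rw [hp.eq, hp.eq], by rw [hp.eq, hp.eq], hp.eq, hp.eq⟩

theorem MvN.symm {p q : R} (h : MvN p q) : MvN q p := by
  obtain ⟨x, y, h1, h2, h3, h4⟩ := h
  exact ⟨y, x, h2, h1, h4, h3⟩

theorem MvN.mul_left {p q x : R} (hp : IsIdempotentElem p) (h : p * x * q = x) : p * x = x := by
  rw [← h, ← mul_assoc, ← mul_assoc, hp.eq]

theorem MvN.mul_right {p q x : R} (hq : IsIdempotentElem q) (h : p * x * q = x) : x * q = x := by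
  rw [← h, mul_assoc, hq.eq]

theorem MvN.trans {p q r : R} (hp : IsIdempotentElem p) (hq : IsIdempotentElem q)
    (hr : IsIdempotentElem r) (h : MvN p q) (h' : MvN q r) : MvN p r := by
  obtain ⟨x, y, h1, h2, h3, h4⟩ := h
  obtain ⟨z, t, h5, h6, h7, h8⟩ := h'
  have e1 := MvN.mul_left hp h1
  have e2 := MvN.mul_right hq h1
  have e3 := MvN.mul_right hp h2
  have e4 := MvN.mul_left hr h6
  have e5 := MvN.mul_right hr h5
  have e6 := MvN.mul_right hq h6
  refine ⟨x * z, t * y, ?_, ?_, ?_, ?_⟩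
  · rw [← mul_assoc p, e1, mul_assoc, e5]
  · rw [← mul_assoc r, e4, mul_assoc, e3]
  · rw [mul_assoc, ← mul_assoc z, h7, ← mul_assoc, e2, h3]
  · rw [mul_assoc, ← mul_assoc y, h4, ← mul_assoc, e6, h8]

theorem idem_add {p q : R} (hp : IsIdempotentElem p) (hq : IsIdempotentElem q)
    (h : p * q = 0) (h' : q * p = 0) : IsIdempotentElem (p + q) := by
  unfold IsIdempotentElem
  rw [mul_add, add_mul, add_mul, hp.eq, hq.eq, h, h', add_zero, zero_add]

theorem MvN.add {p q p' q' : R} (hp : IsIdempotentElem p) (hq : IsIdempotentElem q)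
    (hp' : IsIdempotentElem p') (hq' : IsIdempotentElem q')
    (o1 : p * q = 0) (o2 : q * p = 0) (o3 : p' * q' = 0) (o4 : q' * p' = 0)
    (h : MvN p p') (h' : MvN q q') : MvN (p + q) (p' + q') := by
  obtain ⟨x, y, h1, h2, h3, h4⟩ := h
  obtain ⟨z, t, h5, h6, h7, h8⟩ := h'
  have e1 := MvN.mul_left hp h1
  have e2 := MvN.mul_right hp' h1
  have e3 := MvN.mul_left hp' h2
  have e4 := MvN.mul_right hp h2
  have e5 := MvN.mul_left hq h5
  have e6 := MvN.mul_right hq' h5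
  have e7 := MvN.mul_left hq' h6
  have e8 := MvN.mul_right hq h6
  have f1 : p * z = 0 := by rw [← e5, ← mul_assoc, o1, zero_mul]
  have f2 : q * x = 0 := by rw [← e1, ← mul_assoc, o2, zero_mul]
  have f3 : x * q' = 0 := by rw [← e2, mul_assoc, o3, mul_zero]
  have f4 : z * p' = 0 := by rw [← e6, mul_assoc, o4, mul_zero]
  have f5 : p' * t = 0 := by rw [← e7, ← mul_assoc, o3, zero_mul]
  have f6 : q' * y = 0 := by rw [← e3, ← mul_assoc, o4, zero_mul]
  have f7 : y * q = 0 := by rw [← e4, mul_assoc, o1, mul_zero]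
  have f8 : t * p = 0 := by rw [← e8, mul_assoc, o2, mul_zero]
  have g1 : x * t = 0 := by rw [← e2, mul_assoc, f5, mul_zero]
  have g2 : z * y = 0 := by rw [← e6, mul_assoc, f6, mul_zero]
  have g3 : y * z = 0 := by rw [← e4, mul_assoc, f1, mul_zero]
  have g4 : t * x = 0 := by rw [← e8, mul_assoc, f2, mul_zero]
  refine ⟨x + z, y + t, ?_, ?_, ?_, ?_⟩ <;>
    simp only [mul_add, add_mul, e1, e2, e3, e4, e5, e6, e7, e8, f1, f2, f3, f4, f5, f6, f7, f8,
      g1, g2, g3, g4, h3, h4, h7, h8, add_zero, zero_add]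

end

/-! ### The algebra of finitely supported infinite matrices -/

/-- `M_∞ R`, the union of the matrix algebras `M_n R`: matrices indexed by `ℕ × ℕ` with only
finitely many nonzero entries. -/
@[ext]
structure MInf (R : Type x) [Ring R] where
  /-- the entries -/
  entry : ℕ → ℕ → R
  finite' : ∃ n : ℕ, ∀ i j, n ≤ i ∨ n ≤ j → entry i j = 0

namespace MInf
variable {R : Type x} [Ring R]

theorem entry_injective : Function.Injective (entry : MInf R → ℕ → ℕ → R) :=
  fun _ _ h => MInf.ext h

instance : Zero (MInf R) := ⟨⟨fun _ _ => 0, 0, fun _ _ _ => rfl⟩⟩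

instance : Add (MInf R) := ⟨fun A B => ⟨fun i j => A.entry i j + B.entry i j, by
  obtain ⟨n, hn⟩ := A.finite'
  obtain ⟨m, hm⟩ := B.finite'
  refine ⟨max n m, fun i j h => ?_⟩
  rw [hn i j (h.imp (le_trans (le_max_left _ _)) (le_trans (le_max_left _ _))),
    hm i j (h.imp (le_trans (le_max_right _ _)) (le_trans (le_max_right _ _))), add_zero]⟩⟩

instance : Neg (MInf R) := ⟨fun A => ⟨fun i j => -A.entry i j, by
  obtain ⟨n, hn⟩ := A.finite'
  exact ⟨n, fun i j h => by rw [hn i j h, neg_zero]⟩⟩⟩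

instance : Sub (MInf R) := ⟨fun A B => ⟨fun i j => A.entry i j - B.entry i j, by
  obtain ⟨n, hn⟩ := (A + -B).finite'
  exact ⟨n, fun i j h => (sub_eq_add_neg _ _).trans (hn i j h)⟩⟩⟩

/-- Scalars of any module structure compatible with that of `R` act entrywise. -/
instance {l : Type w} [SMulZeroClass l R] : SMul l (MInf R) := ⟨fun c A =>
  ⟨fun i j => c • A.entry i j, by
    obtain ⟨n, hn⟩ := A.finite'
    exact ⟨n, fun i j h => by rw [hn i j h, smul_zero]⟩⟩⟩

/-- Matrix multiplication; the sum has only finitely many nonzero terms. -/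
noncomputable instance : Mul (MInf R) := ⟨fun A B =>
  ⟨fun i j => ∑ᶠ k, A.entry i k * B.entry k j, by
    obtain ⟨n, hn⟩ := A.finite'
    obtain ⟨m, hm⟩ := B.finite'
    refine ⟨max n m, fun i j h => ?_⟩
    rw [← finsum_zero (α := ℕ)]
    refine finsum_congr fun k => ?_
    rcases h with h | h
    · rw [hn i k (Or.inl ((le_max_left _ _).trans h)), zero_mul]
    · rw [hm k j (Or.inr ((le_max_right _ _).trans h)), mul_zero]⟩⟩

theorem mul_entry (A B : MInf R) (i j : ℕ) :
    (A * B).entry i j = ∑ᶠ k, A.entry i k * B.entry k j := rfl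

theorem finsum_eq_range {n : ℕ} {f : ℕ → R} (h : ∀ k, n ≤ k → f k = 0) :
    ∑ᶠ k, f k = ∑ k ∈ Finset.range n, f k := by
  refine finsum_eq_sum_of_support_subset _ fun k hk => ?_
  by_contra hk'
  exact hk (h k (by simpa using hk'))

instance : AddCommGroup (MInf R) :=
  Function.Injective.addCommGroup entry entry_injective rfl (fun _ _ => rfl) (fun _ => rfl)
    (fun _ _ => rfl) (fun _ _ => rfl) (fun _ _ => rfl)

theorem zero_entry (i j : ℕ) : (0 : MInf R).entry i j = 0 := rfl

theorem add_entry (A B : MInf R) (i j : ℕ) :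
    (A + B).entry i j = A.entry i j + B.entry i j := rfl

theorem mul_entry_left (A B : MInf R) (i j : ℕ) {n : ℕ} (hn : ∀ k, n ≤ k → A.entry i k = 0) :
    (A * B).entry i j = ∑ k ∈ Finset.range n, A.entry i k * B.entry k j :=
  finsum_eq_range fun k hk => by rw [hn k hk, zero_mul]

theorem mul_entry_right (A B : MInf R) (i j : ℕ) {n : ℕ} (hn : ∀ k, n ≤ k → B.entry k j = 0) :
    (A * B).entry i j = ∑ k ∈ Finset.range n, A.entry i k * B.entry k j :=
  finsum_eq_range fun k hk => by rw [hn k hk, mul_zero]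

noncomputable instance : NonUnitalRing (MInf R) where
  left_distrib A B C := by
    ext i j
    obtain ⟨n, hn⟩ := A.finite'
    have h : ∀ k, n ≤ k → A.entry i k = 0 := fun k hk => hn i k (Or.inr hk)
    rw [add_entry, mul_entry_left _ _ _ _ h, mul_entry_left _ _ _ _ h, mul_entry_left _ _ _ _ h,
      ← Finset.sum_add_distrib]
    exact Finset.sum_congr rfl fun k _ => mul_add _ _ _
  right_distrib A B C := by
    ext i j
    obtain ⟨n, hn⟩ := C.finite'
    have h : ∀ k, n ≤ k → C.entry k j = 0 := fun k hk => hn k j (Or.inl hk)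
    rw [add_entry, mul_entry_right _ _ _ _ h, mul_entry_right _ _ _ _ h,
      mul_entry_right _ _ _ _ h, ← Finset.sum_add_distrib]
    exact Finset.sum_congr rfl fun k _ => add_mul _ _ _
  zero_mul A := by
    ext i j
    rw [mul_entry, zero_entry]
    exact (finsum_congr fun k => zero_mul (A.entry k j)).trans finsum_zero
  mul_zero A := by
    ext i j
    rw [mul_entry, zero_entry]
    exact (finsum_congr fun k => mul_zero (A.entry i k)).trans finsum_zero
  mul_assoc A B C := by
    ext i j
    obtain ⟨n, hn⟩ := A.finite'
    obtain ⟨m, hm⟩ := C.finite'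
    have hA : ∀ k, n ≤ k → A.entry i k = 0 := fun k hk => hn i k (Or.inr hk)
    have hC : ∀ k, m ≤ k → C.entry k j = 0 := fun k hk => hm k j (Or.inl hk)
    rw [mul_entry_right _ _ _ _ hC, mul_entry_left _ _ _ _ hA]
    simp_rw [mul_entry_left _ B _ _ hA, mul_entry_right B _ _ _ hC, Finset.sum_mul,
      Finset.mul_sum]
    rw [Finset.sum_comm]
    simp_rw [mul_assoc]

section
variable {l : Type w} [CommSemiring l] [Algebra l R]

noncomputable instance : Module l (MInf R) :=
  Function.Injective.module l
    ({ toFun := entry, map_zero' := rfl, map_add' := fun _ _ => rfl } : MInf R →+ (ℕ → ℕ → R))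
    entry_injective (fun _ _ => rfl)

instance : IsScalarTower l (MInf R) (MInf R) := ⟨fun c A B => by
  ext i j
  obtain ⟨n, hn⟩ := B.finite'
  have h : ∀ k, n ≤ k → B.entry k j = 0 := fun k hk => hn k j (Or.inl hk)
  change ((c • A) * B).entry i j = c • (A * B).entry i j
  rw [mul_entry_right _ _ _ _ h, mul_entry_right _ _ _ _ h, Finset.smul_sum]
  exact Finset.sum_congr rfl fun k _ => smul_mul_assoc _ _ _⟩

instance : SMulCommClass l (MInf R) (MInf R) := ⟨fun c A B => by
  ext i j
  obtain ⟨n, hn⟩ := A.finite'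
  have h : ∀ k, n ≤ k → A.entry i k = 0 := fun k hk => hn i k (Or.inr hk)
  change c • (A * B).entry i j = (A * (c • B)).entry i j
  rw [mul_entry_left _ _ _ _ h, mul_entry_left _ _ _ _ h, Finset.smul_sum]
  exact Finset.sum_congr rfl fun k _ => (mul_smul_comm _ _ _).symm⟩

end

/-- The inclusion `R → M_∞ R`, `a ↦ ε₁₁ ⊗ a`, into the upper left corner. -/
def corner (a : R) : MInf R where
  entry i j := if i = 0 ∧ j = 0 then a else 0
  finite' := ⟨1, fun i j h => if_neg (by omega)⟩

theorem corner_idem {a : R} (ha : IsIdempotentElem a) : IsIdempotentElem (corner a) := by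
  ext i j
  rw [mul_entry_left (n := 1)]
  · by_cases hi : i = 0 <;> by_cases hj : j = 0 <;> simp [corner, hi, hj, ha.eq]
  · intro k hk
    exact if_neg (by omega)

/-- Moves the entry at `(a, b)` to `(f a, g b)`; all other entries of the result vanish. -/
noncomputable def move (f g : ℕ ↪ ℕ) (A : MInf R) : MInf R where
  entry := Function.extend f (fun a => Function.extend g (A.entry a) 0) 0
  finite' := by
    obtain ⟨n, hn⟩ := A.finite'
    refine ⟨(∑ a ∈ Finset.range n, f a) + (∑ a ∈ Finset.range n, g a) + 1, fun i j h => ?_⟩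
    by_cases hi : ∃ a, f a = i
    · obtain ⟨a, rfl⟩ := hi
      rw [f.injective.extend_apply]
      by_cases hj : ∃ b, g b = j
      · obtain ⟨b, rfl⟩ := hj
        rw [g.injective.extend_apply]
        apply hn
        by_contra! hc
        have h1 := Finset.single_le_sum (f := fun a => f a) (fun _ _ => Nat.zero_le _)
          (Finset.mem_range.2 hc.1)
        have h2 := Finset.single_le_sum (f := fun a => g a) (fun _ _ => Nat.zero_le _)
          (Finset.mem_range.2 hc.2)
        omega
      · rw [Function.extend_apply' _ _ _ hj]; rfl
    · rw [Function.extend_apply' _ _ _ hi]; rfl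

theorem move_entry (f g : ℕ ↪ ℕ) (A : MInf R) (a b : ℕ) :
    (move f g A).entry (f a) (g b) = A.entry a b := by
  simp only [move]
  rw [f.injective.extend_apply, g.injective.extend_apply]

theorem move_entry_row (f g : ℕ ↪ ℕ) (A : MInf R) {i : ℕ} (j : ℕ) (hi : ¬ ∃ a, f a = i) :
    (move f g A).entry i j = 0 := by
  simp only [move]
  rw [Function.extend_apply' _ _ _ hi]; rfl

theorem move_entry_col (f g : ℕ ↪ ℕ) (A : MInf R) (i : ℕ) {j : ℕ} (hj : ¬ ∃ a, g a = j) :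
    (move f g A).entry i j = 0 := by
  by_cases hi : ∃ a, f a = i
  · obtain ⟨a, rfl⟩ := hi
    simp only [move]
    rw [f.injective.extend_apply, Function.extend_apply' _ _ _ hj]; rfl
  · exact move_entry_row f g A j hi

theorem move_mul (f g h : ℕ ↪ ℕ) (A B : MInf R) :
    move f g A * move g h B = move f h (A * B) := by
  ext i j
  by_cases hi : ∃ a, f a = i
  · obtain ⟨a, rfl⟩ := hi
    by_cases hj : ∃ b, h b = j
    · obtain ⟨b, rfl⟩ := hj
      rw [move_entry, mul_entry, mul_entry]
      have hs : (Function.support fun k =>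
          (move f g A).entry (f a) k * (move g h B).entry k (h b)) ⊆ Set.range g := by
        intro k hk
        by_contra hc
        exact hk (by simp only; rw [move_entry_col f g A _ hc, zero_mul])
      rw [← finsum_mem_univ, finsum_mem_inter_support_eq _ Set.univ (Set.range g)
        (by rw [Set.univ_inter, Set.inter_eq_right.2 hs]), finsum_mem_range g.injective]
      exact finsum_congr fun k => by rw [move_entry, move_entry]
    · rw [move_entry_col _ _ _ _ hj, mul_entry, ← finsum_zero (α := ℕ)]
      exact finsum_congr fun k => by rw [move_entry_col _ _ _ _ hj, mul_zero]
  · rw [move_entry_row _ _ _ _ hi, mul_entry, ← finsum_zero (α := ℕ)]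
    exact finsum_congr fun k => by rw [move_entry_row _ _ _ _ hi, zero_mul]

theorem move_mul_of_disjoint (f g g' h : ℕ ↪ ℕ) (hd : ∀ a b, g a ≠ g' b) (A B : MInf R) :
    move f g A * move g' h B = 0 := by
  ext i j
  rw [mul_entry, zero_entry, ← finsum_zero (α := ℕ)]
  refine finsum_congr fun k => ?_
  by_cases hk : ∃ a, g a = k
  · obtain ⟨a, rfl⟩ := hk
    rw [move_entry_row g' h B j (fun ⟨b, hb⟩ => hd a b hb.symm), mul_zero]
  · rw [move_entry_col _ _ _ _ hk, zero_mul]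

theorem move_refl (A : MInf R) : move (.refl ℕ) (.refl ℕ) A = A := by
  ext i j
  exact move_entry (.refl ℕ) (.refl ℕ) A i j

theorem move_idem (f : ℕ ↪ ℕ) {p : MInf R} (hp : IsIdempotentElem p) :
    IsIdempotentElem (move f f p) := by
  unfold IsIdempotentElem
  rw [move_mul, hp.eq]

theorem mvn_move (f : ℕ ↪ ℕ) {p : MInf R} (hp : IsIdempotentElem p) : MvN p (move f f p) := by
  refine ⟨move (.refl ℕ) f p, move f (.refl ℕ) p, ?_, ?_, ?_, ?_⟩
  · nth_rewrite 1 [← move_refl p]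
    rw [move_mul, move_mul, hp.eq, hp.eq]
  · nth_rewrite 3 [← move_refl p]
    rw [move_mul, move_mul, hp.eq, hp.eq]
  · rw [move_mul, hp.eq, move_refl]
  · rw [move_mul, hp.eq]

/-- `n ↦ 2n`. -/
def even : ℕ ↪ ℕ := ⟨fun n => 2 * n, fun a b h => by simp only at h; omega⟩

/-- `n ↦ 2n + 1`. -/
def odd : ℕ ↪ ℕ := ⟨fun n => 2 * n + 1, fun a b h => by simp only at h; omega⟩

theorem even_ne_odd (a b : ℕ) : even a ≠ odd b := by
  change 2 * a ≠ 2 * b + 1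
  omega

/-- The direct sum `A ⊕ B`: a copy of `A` in the even rows and columns and a copy of `B` in the
odd ones. -/
noncomputable def dsum (A B : MInf R) : MInf R := move even even A + move odd odd B

theorem even_mul_odd (A B : MInf R) : move even even A * move odd odd B = 0 :=
  move_mul_of_disjoint _ _ _ _ even_ne_odd A B

theorem odd_mul_even (A B : MInf R) : move odd odd A * move even even B = 0 :=
  move_mul_of_disjoint _ _ _ _ (fun a b => (even_ne_odd b a).symm) A B

theorem dsum_idem {p q : MInf R} (hp : IsIdempotentElem p) (hq : IsIdempotentElem q) :
    IsIdempotentElem (dsum p q) :=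
  idem_add (move_idem _ hp) (move_idem _ hq) (even_mul_odd _ _) (odd_mul_even _ _)

/-- A sum of orthogonal idempotents equivalent to `p` and `q` is equivalent to `p ⊕ q`. -/
theorem dsum_mvn {p q p' q' : MInf R} (hp : IsIdempotentElem p) (hq : IsIdempotentElem q)
    (hp' : IsIdempotentElem p') (hq' : IsIdempotentElem q') (h : MvN p p') (h' : MvN q q')
    (o : p' * q' = 0) (o' : q' * p' = 0) : MvN (dsum p q) (p' + q') :=
  MvN.add (move_idem _ hp) (move_idem _ hq) hp' hq' (even_mul_odd _ _) (odd_mul_even _ _) o o'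
    ((mvn_move even hp).symm.trans (move_idem _ hp) hp hp' h)
    ((mvn_move odd hq).symm.trans (move_idem _ hq) hq hq' h')

end MInf

/-! ### The monoid `V(R)` and the group `K₀(R)` -/

section
variable (R : Type x) [Ring R]

/-- The idempotents of `M_∞ R`. -/
abbrev IdemInf : Type x := {p : MInf R // IsIdempotentElem p}

/-- Murray-von Neumann equivalence on the idempotents of `M_∞ R`. -/
def mvnSetoid : Setoid (IdemInf R) where
  r p q := MvN p.1 q.1
  iseqv := ⟨fun p => MvN.refl p.2, fun h => h.symm,
    fun {p q r} h h' => h.trans p.2 q.2 r.2 h'⟩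

/-- `V(R)`: Murray-von Neumann equivalence classes of idempotents in `M_∞ R`. -/
def V : Type x := Quotient (mvnSetoid R)

variable {R}

/-- The class in `V(R)` of an idempotent of `M_∞ R`. -/
def V.mk (p : IdemInf R) : V R := Quotient.mk (mvnSetoid R) p

theorem V.sound {p q : IdemInf R} (h : MvN p.1 q.1) : V.mk p = V.mk q :=
  Quotient.sound (s := mvnSetoid R) h

theorem V.exists_rep (a : V R) : ∃ p, V.mk p = a := Quotient.exists_rep a

noncomputable instance : Add (V R) := ⟨Quotient.map₂
  (fun p q => ⟨MInf.dsum p.1 q.1, MInf.dsum_idem p.2 q.2⟩) (fun p p' h q q' h' =>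
    MInf.dsum_mvn p.2 q.2 (MInf.move_idem _ p'.2) (MInf.move_idem _ q'.2)
      (MvN.trans p.2 p'.2 (MInf.move_idem _ p'.2) h (MInf.mvn_move _ p'.2))
      (MvN.trans q.2 q'.2 (MInf.move_idem _ q'.2) h' (MInf.mvn_move _ q'.2))
      (MInf.even_mul_odd _ _) (MInf.odd_mul_even _ _))⟩

instance : Zero (V R) := ⟨V.mk ⟨0, mul_zero 0⟩⟩

theorem V.mk_add (p q : IdemInf R) :
    V.mk p + V.mk q = V.mk ⟨MInf.dsum p.1 q.1, MInf.dsum_idem p.2 q.2⟩ := rfl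

/-- The sum of the classes of two orthogonal idempotents is the class of their sum. -/
theorem V.mk_add_of_orthogonal (p q : IdemInf R) (h : p.1 * q.1 = 0) (h' : q.1 * p.1 = 0) :
    V.mk p + V.mk q = V.mk ⟨p.1 + q.1, idem_add p.2 q.2 h h'⟩ :=
  V.sound (MInf.dsum_mvn p.2 q.2 p.2 q.2 (MvN.refl p.2) (MvN.refl q.2) h h')

theorem V.add_comm' (a b : V R) : a + b = b + a := by
  obtain ⟨p, rfl⟩ := a.exists_rep
  obtain ⟨q, rfl⟩ := b.exists_rep
  refine V.sound ?_
  have := MInf.dsum_mvn p.2 q.2 (MInf.move_idem MInf.odd p.2) (MInf.move_idem MInf.even q.2)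
    (MInf.mvn_move _ p.2) (MInf.mvn_move _ q.2) (MInf.odd_mul_even _ _) (MInf.even_mul_odd _ _)
  rwa [add_comm] at this

theorem V.zero_add' (a : V R) : 0 + a = a := by
  obtain ⟨p, rfl⟩ := a.exists_rep
  refine (V.mk_add_of_orthogonal ⟨0, mul_zero 0⟩ p (zero_mul _) (mul_zero _)).trans ?_
  exact V.sound (by simpa using MvN.refl p.2)

theorem V.mk_move (f : ℕ ↪ ℕ) (p : IdemInf R) :
    V.mk ⟨MInf.move f f p.1, MInf.move_idem f p.2⟩ = V.mk p :=
  V.sound (MInf.mvn_move f p.2).symm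

theorem V.add_assoc' (a b c : V R) : a + b + c = a + (b + c) := by
  obtain ⟨p, rfl⟩ := a.exists_rep
  obtain ⟨q, rfl⟩ := b.exists_rep
  obtain ⟨r, rfl⟩ := c.exists_rep
  let f : ℕ ↪ ℕ := ⟨fun n => 3 * n, fun a b h => by simp only at h; omega⟩
  let g : ℕ ↪ ℕ := ⟨fun n => 3 * n + 1, fun a b h => by simp only at h; omega⟩
  let k : ℕ ↪ ℕ := ⟨fun n => 3 * n + 2, fun a b h => by simp only at h; omega⟩
  have hfg : ∀ a b, f a ≠ g b := fun a b => by
    change 3 * a ≠ 3 * b + 1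
    omega
  have hfk : ∀ a b, f a ≠ k b := fun a b => by
    change 3 * a ≠ 3 * b + 2
    omega
  have hgk : ∀ a b, g a ≠ k b := fun a b => by
    change 3 * a + 1 ≠ 3 * b + 2
    omega
  have o1 := MInf.move_mul_of_disjoint f f g g hfg p.1 q.1
  have o2 := MInf.move_mul_of_disjoint g g f f (fun a b => (hfg b a).symm) q.1 p.1
  have o3 := MInf.move_mul_of_disjoint f f k k hfk p.1 r.1
  have o4 := MInf.move_mul_of_disjoint k k f f (fun a b => (hfk b a).symm) r.1 p.1
  have o5 := MInf.move_mul_of_disjoint g g k k hgk q.1 r.1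
  have o6 := MInf.move_mul_of_disjoint k k g g (fun a b => (hgk b a).symm) r.1 q.1
  rw [← V.mk_move f p, ← V.mk_move g q, ← V.mk_move k r,
    V.mk_add_of_orthogonal ⟨_, MInf.move_idem f p.2⟩ ⟨_, MInf.move_idem g q.2⟩ o1 o2,
    V.mk_add_of_orthogonal ⟨_, MInf.move_idem g q.2⟩ ⟨_, MInf.move_idem k r.2⟩ o5 o6,
    V.mk_add_of_orthogonal _ _ (by rw [add_mul, o3, o5, add_zero])
      (by rw [mul_add, o4, o6, add_zero]),
    V.mk_add_of_orthogonal _ _ (by rw [mul_add, o1, o3, add_zero])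
      (by rw [add_mul, o2, o4, add_zero])]
  exact congrArg V.mk (Subtype.ext (add_assoc _ _ _))

noncomputable instance : AddCommMonoid (V R) where
  add_assoc := V.add_assoc'
  zero_add := V.zero_add'
  add_zero a := (V.add_comm' a 0).trans (V.zero_add' a)
  add_comm := V.add_comm'
  nsmul := nsmulRec

variable (R)

/-- `K₀(R)` of a unital ring: the group completion of `V(R)`. -/
abbrev K0 : Type x := Algebra.GrothendieckAddGroup (V R)

/-- The class `[1_R]` in `K₀(R)`. -/
noncomputable def K0.one : K0 R :=
  Algebra.GrothendieckAddGroup.of (V.mk ⟨MInf.corner (1 : R), MInf.corner_idem (mul_one 1)⟩)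

end

/-- `e` is a two-sided identity element of the ring `A`. -/
def IsIdentityElem {A : Type x} [NonUnitalRing A] (e : A) : Prop :=
  ∀ a : A, e * a = a ∧ a * e = a

end Leavitt

/-! Since `L(E)` is simple, any homomorphism that does not kill some vertex is injective. So the
task is to represent the generators in `R`. It suffices to have an idempotent `e ≠ 0` that is a sum
of two orthogonal idempotents equivalent to `e`. Repeated subdivision then gives copies of `e`
indexed by any countable set, adding up to `e` if the set is finite and nonempty. Vertices go to
such copies, and the copy at each vertex is subdivided again along the edges it emits
(`exists_hom_of_partition`).

Pure infiniteness gives a proper isometry and simplicity a second one with orthogonal range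
(`exists_isometryFamily`). For isometries `s₁`, `s₂` with left inverses `t₁`, `t₂` and `r = 1 - s₁t₁
- s₂t₂`, one has `[1] = 2[1] + [r]`. Hence `e = s₁t₁ + r`, of class `[1] + [r]`, satisfies `2[e] =
[e]` (`exists_partition`). This embeds `L(E)` in `R` for every countable `E`, and in `M_∞ R` through
the corner.

If `[1] = 0` in `K₀(R)`, then `2[1] = [1]` already in `V(R)` (`V.one_add_one`), so `e = 1` is
possible. With finitely many vertices their images add up to `1`. -/

namespace Leavitt

/-! ### Orthogonal isometries and subdivision of an idempotent -/

section
variable {R : Type x} [Ring R]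

/-- A family of isometries with pairwise orthogonal ranges in the corner ring of `e`. -/
structure IsometryFamily {ι : Type*} (e : R) (A B : ι → R) : Prop where
  mul_self : ∀ i, B i * A i = e
  mul_of_ne : ∀ i j, i ≠ j → B i * A j = 0
  left_mul : ∀ i, e * A i = A i
  mul_left : ∀ i, A i * e = A i
  right_mul : ∀ i, e * B i = B i
  mul_right : ∀ i, B i * e = B i

/-- A family whose range projections add up to `e` whenever its index type is finite and
nonempty. -/
def IsComplete {ι : Type*} (e : R) (A B : ι → R) : Prop :=
  ∀ S : Finset ι, (∀ i, i ∈ S) → S.Nonempty → ∑ i ∈ S, A i * B i = e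

namespace IsometryFamily

variable {ι κ : Type*} {e : R} {A B : ι → R}

theorem comp (h : IsometryFamily e A B) (g : κ → ι) (hg : Function.Injective g) :
    IsometryFamily e (A ∘ g) (B ∘ g) where
  mul_self _ := h.mul_self _
  mul_of_ne _ _ hij := h.mul_of_ne _ _ (hg.ne hij)
  left_mul _ := h.left_mul _
  mul_left _ := h.mul_left _
  right_mul _ := h.right_mul _
  mul_right _ := h.mul_right _

/-- The words `A false ^ n * A true` work: common leading factors `A false` cancel against `B
false`, after which distinct words start with different letters. -/
theorem exists_nat {A B : Bool → R} (h : IsometryFamily e A B) :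
    ∃ A' B' : ℕ → R, IsometryFamily e A' B' := by
  let A' : ℕ → R := fun n => Nat.rec (A true) (fun _ a => A false * a) n
  let B' : ℕ → R := fun n => Nat.rec (B true) (fun _ b => b * B false) n
  have hA : ∀ n, A' (n + 1) = A false * A' n := fun _ => rfl
  have hB : ∀ n, B' (n + 1) = B' n * B false := fun _ => rfl
  have hl : ∀ n, e * A' n = A' n := by
    rintro (_ | n)
    · exact h.left_mul _
    · rw [hA, ← mul_assoc, h.left_mul]
  have hs : ∀ i j, B' (i + 1) * A' (j + 1) = B' i * A' j := fun i j => by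
    rw [hA, hB, mul_assoc, ← mul_assoc (B false), h.mul_self, hl]
  refine ⟨A', B', ⟨fun i => ?_, fun i => ?_, hl, fun i => ?_, fun i => ?_, fun i => ?_⟩⟩
  · induction i with
    | zero => exact h.mul_self _
    | succ i ih => rw [hs, ih]
  · induction i with
    | zero =>
      rintro (_ | j) hij
      · exact absurd rfl hij
      · rw [hA, ← mul_assoc, show B' 0 = B true from rfl, h.mul_of_ne _ _ (by simp), zero_mul]
    | succ i ih =>
      rintro (_ | j) hij
      · rw [hB, mul_assoc, show A' 0 = A true from rfl, h.mul_of_ne _ _ (by simp), mul_zero]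
      · rw [hs, ih j (by omega)]
  · induction i with
    | zero => exact h.mul_left _
    | succ i ih => rw [hA, mul_assoc, ih]
  · induction i with
    | zero => exact h.right_mul _
    | succ i ih => rw [hB, ← mul_assoc, ih]
  · cases i with
    | zero => exact h.mul_right _
    | succ i => rw [hB, mul_assoc, h.mul_right]

/-- Keep the range of `A true` and subdivide that of `A false`. The undivided `e` is the case of one
piece, whence the index `n + 1`. -/
theorem exists_fin {A B : Bool → R} (h : IsometryFamily e A B)
    (hc : A true * B true + A false * B false = e) (he : IsIdempotentElem e) (n : ℕ) :
    ∃ A' B' : Fin (n + 1) → R, IsometryFamily e A' B' ∧ ∑ i, A' i * B' i = e := by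
  induction n with
  | zero =>
    refine ⟨fun _ => e, fun _ => e, ⟨fun _ => he.eq, fun i j hij => ?_, fun _ => he.eq,
      fun _ => he.eq, fun _ => he.eq, fun _ => he.eq⟩, by simp [he.eq]⟩
    exact absurd (Subsingleton.elim (α := Fin 1) i j) hij
  | succ n ih =>
    obtain ⟨A', B', h', hs⟩ := ih
    refine ⟨Fin.cons (A true) fun i => A false * A' i, Fin.cons (B true) fun i => B' i * B false,
      ⟨fun i => ?_, fun i j hij => ?_, fun i => ?_, fun i => ?_, fun i => ?_, fun i => ?_⟩, ?_⟩
    · induction i using Fin.cases with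
      | zero => exact h.mul_self _
      | succ i =>
        simp only [Fin.cons_succ]
        rw [mul_assoc, ← mul_assoc (B false), h.mul_self, h'.left_mul, h'.mul_self]
    · induction i using Fin.cases with
      | zero =>
        induction j using Fin.cases with
        | zero => exact absurd rfl hij
        | succ j =>
          simp only [Fin.cons_succ, Fin.cons_zero]
          rw [← mul_assoc, h.mul_of_ne _ _ (by simp), zero_mul]
      | succ i =>
        induction j using Fin.cases with
        | zero =>
          simp only [Fin.cons_succ, Fin.cons_zero]
          rw [mul_assoc, h.mul_of_ne _ _ (by simp), mul_zero]
        | succ j =>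
          simp only [Fin.cons_succ]
          rw [mul_assoc, ← mul_assoc (B false), h.mul_self, h'.left_mul,
            h'.mul_of_ne _ _ fun hh => hij (congrArg Fin.succ hh)]
    · induction i using Fin.cases with
      | zero => exact h.left_mul _
      | succ i => rw [Fin.cons_succ, ← mul_assoc, h.left_mul]
    · induction i using Fin.cases with
      | zero => exact h.mul_left _
      | succ i => rw [Fin.cons_succ, mul_assoc, h'.mul_left]
    · induction i using Fin.cases with
      | zero => exact h.right_mul _
      | succ i => rw [Fin.cons_succ, ← mul_assoc, h'.right_mul]
    · induction i using Fin.cases with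
      | zero => exact h.mul_right _
      | succ i => rw [Fin.cons_succ, mul_assoc, h.mul_right]
    · rw [Fin.sum_univ_succ]
      simp only [Fin.cons_succ, Fin.cons_zero]
      rw [← hc]
      congr 1
      have : ∀ i, A false * A' i * (B' i * B false) = A false * (A' i * B' i) * B false :=
        fun i => by simp only [mul_assoc]
      simp_rw [this]
      rw [← Finset.sum_mul, ← Finset.mul_sum, hs, h.mul_left]

/-- A two-element partition of `e` into copies of itself yields a complete family over every
countable index type. -/
theorem exists_countable {A B : Bool → R} (h : IsometryFamily e A B)
    (hc : A true * B true + A false * B false = e) (he : IsIdempotentElem e)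
    (ι : Type*) [Countable ι] :
    ∃ A' B' : ι → R, IsometryFamily e A' B' ∧ IsComplete e A' B' := by
  cases finite_or_infinite ι with
  | inl _ =>
    obtain ⟨n, ⟨g⟩⟩ := Finite.exists_equiv_fin ι
    cases n with
    | zero =>
      have : IsEmpty ι := g.isEmpty
      exact ⟨isEmptyElim, isEmptyElim, ⟨isEmptyElim, isEmptyElim, isEmptyElim, isEmptyElim,
        isEmptyElim, isEmptyElim⟩, fun S _ hS => isEmptyElim hS.choose⟩
    | succ n =>
      obtain ⟨A', B', h', hs⟩ := h.exists_fin hc he n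
      refine ⟨_, _, h'.comp g g.injective, fun S hS _ => ?_⟩
      rw [← hs]
      exact Finset.sum_bij (fun i _ => g i) (fun _ _ => Finset.mem_univ _)
        (fun _ _ _ _ hij => g.injective hij) (fun j _ => ⟨g.symm j, hS _, by simp⟩)
        (fun _ _ => rfl)
  -- No finite set exhausts the index type, so completeness is vacuous and orthogonality is enough.
  | inr _ =>
    obtain ⟨A', B', h'⟩ := h.exists_nat
    obtain ⟨g, hg⟩ := exists_injective_nat ι
    exact ⟨_, _, h'.comp g hg, fun S hS _ => (Set.infinite_univ.not_finite
      (S.finite_toSet.subset fun i _ => hS i)).elim⟩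

/-! ### An idempotent that splits into two copies of itself -/

set_option linter.unusedSimpArgs false in
/-- Two isometries with orthogonal ranges in `R` yield a nonzero idempotent `e` that is the sum
of two orthogonal idempotents equivalent to `e`. -/
theorem exists_partition [Nontrivial R] {s t : Bool → R} (h : IsometryFamily 1 s t) :
    ∃ (e : R) (A B : Bool → R), IsIdempotentElem e ∧ e ≠ 0 ∧ IsometryFamily e A B ∧
      A true * B true + A false * B false = e := by
  obtain ⟨s₁, hs₁⟩ : ∃ a, a = s true := ⟨_, rfl⟩
  obtain ⟨s₂, hs₂⟩ : ∃ a, a = s false := ⟨_, rfl⟩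
  obtain ⟨t₁, ht₁⟩ : ∃ a, a = t true := ⟨_, rfl⟩
  obtain ⟨t₂, ht₂⟩ : ∃ a, a = t false := ⟨_, rfl⟩
  have h11 : t₁ * s₁ = 1 := by rw [hs₁, ht₁, h.mul_self]
  have h22 : t₂ * s₂ = 1 := by rw [hs₂, ht₂, h.mul_self]
  have h12 : t₁ * s₂ = 0 := by rw [hs₂, ht₁, h.mul_of_ne _ _ (by simp)]
  have h21 : t₂ * s₁ = 0 := by rw [hs₁, ht₂, h.mul_of_ne _ _ (by simp)]
  obtain ⟨r, hr⟩ : ∃ r, r = 1 - s₁ * t₁ - s₂ * t₂ := ⟨_, rfl⟩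
  have k11 : ∀ z, t₁ * (s₁ * z) = z := fun z => by rw [← mul_assoc, h11, one_mul]
  have k22 : ∀ z, t₂ * (s₂ * z) = z := fun z => by rw [← mul_assoc, h22, one_mul]
  have k12 : ∀ z, t₁ * (s₂ * z) = 0 := fun z => by rw [← mul_assoc, h12, zero_mul]
  have k21 : ∀ z, t₂ * (s₁ * z) = 0 := fun z => by rw [← mul_assoc, h21, zero_mul]
  have r1 : r * s₁ = 0 := by
    rw [hr]; simp only [sub_mul, mul_assoc, h11, h21, one_mul, mul_one, mul_zero, sub_self]
  have r2 : r * s₂ = 0 := by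
    rw [hr]; simp only [sub_mul, mul_assoc, h12, h22, one_mul, mul_one, mul_zero, sub_zero, sub_self]
  have t1 : t₁ * r = 0 := by
    rw [hr]; simp only [mul_sub, k11, k12, mul_one, sub_self]
  have t2 : t₂ * r = 0 := by
    rw [hr]; simp only [mul_sub, k21, k22, mul_one, sub_zero, sub_self]
  have rr : r * r = r := by
    nth_rewrite 2 [hr]
    simp only [mul_sub, mul_one, ← mul_assoc, r1, r2, zero_mul, sub_zero]
  have r1' : ∀ z, r * (s₁ * z) = 0 := fun z => by rw [← mul_assoc, r1, zero_mul]
  have r2' : ∀ z, r * (s₂ * z) = 0 := fun z => by rw [← mul_assoc, r2, zero_mul]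
  have t1' : ∀ z, t₁ * (r * z) = 0 := fun z => by rw [← mul_assoc, t1, zero_mul]
  have t2' : ∀ z, t₂ * (r * z) = 0 := fun z => by rw [← mul_assoc, t2, zero_mul]
  have rr' : ∀ z, r * (r * z) = r * z := fun z => by rw [← mul_assoc, rr]
  -- The summand `s₁t₁` is a copy of `1 = s₁t₁ + s₂t₂ + r`. One copy of `e` consists of `s₁(s₁t₁)t₁`
  -- and the outer `r`, the other of `s₁(s₂t₂)t₁` and `s₁rt₁`.
  refine ⟨s₁ * t₁ + r, fun b => cond b (s₁ * s₁ * t₁ + r) (s₁ * s₂ * t₁ + s₁ * r),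
    fun b => cond b (s₁ * t₁ * t₁ + r) (s₁ * t₂ * t₁ + r * t₁), ?_, fun h0 => ?_,
    ⟨?_, ?_, ?_, ?_, ?_, ?_⟩, ?_⟩
  · unfold IsIdempotentElem
    simp only [add_mul, mul_add, mul_assoc, k11, r1', t1, rr, mul_zero, add_zero, zero_add]
  -- Compressing `e` by `t₁` and `s₁` gives `1`.
  · have := congrArg (fun z => t₁ * z * s₁) h0
    simp [mul_add, add_mul, mul_assoc, k11, h11, t1'] at this
  · rintro (_ | _) <;>
      simp only [cond_true, cond_false, add_mul, mul_add, mul_assoc, k11, k22, k12, k21, r1', r2',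
        t1', t2', t1, t2, rr, rr', mul_zero, add_zero, zero_add]
  · rintro (_ | _) (_ | _) hij <;> first | exact absurd rfl hij | skip
    all_goals
      simp only [cond_true, cond_false, add_mul, mul_add, mul_assoc, k11, k22, k12, k21, r1', r2',
        t1', t2', t1, t2, rr, rr', mul_zero, add_zero, zero_add]
  on_goal 5 =>
    have hone : s₁ * (s₁ * (t₁ * t₁)) + s₁ * (s₂ * (t₂ * t₁)) + s₁ * (r * t₁) = s₁ * t₁ := by
      rw [hr]
      simp only [sub_mul, mul_sub, one_mul, mul_assoc]
      abel
    simp only [cond_true, cond_false, add_mul, mul_add, mul_assoc, k11, k22, k12, k21, r1', r2',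
        t1', t2', t1, t2, rr, rr', mul_zero, add_zero, zero_add]
    rw [← hone]
    abel
  all_goals
    rintro (_ | _) <;>
      simp only [cond_true, cond_false, add_mul, mul_add, mul_assoc, k11, k22, k12, k21, r1', r2',
        t1', t2', t1, t2, rr, rr', mul_zero, add_zero, zero_add]

end IsometryFamily

/-! ### Orthogonal isometries from pure infiniteness and simplicity -/

/-- If the proper isometry `s` has left inverse `t`, every element of the ideal generated by
`1 - s * t` factors through the complements of the ranges of powers of `s`. -/
theorem exists_factorization_of_mem_span {s t : R} (hts : t * s = 1) {a : R}
    (ha : a ∈ TwoSidedIdeal.span {1 - s * t}) :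
    ∃ (n : ℕ) (S T : R), T * S = a ∧ t ^ n * S = 0 ∧ T * s ^ n = 0 := by
  have hpow : ∀ n : ℕ, t ^ n * s ^ n = 1 := fun n => pow_mul_pow_eq_one n hts
  have hr : (1 - s * t) * (1 - s * t) = 1 - s * t := by
    have : s * t * (s * t) = s * t := by rw [mul_assoc, ← mul_assoc t, hts, one_mul]
    simp only [mul_sub, sub_mul, mul_one, one_mul, this, sub_self, sub_zero]
  have htr : t * (1 - s * t) = 0 := by rw [mul_sub, ← mul_assoc, hts, mul_one, one_mul, sub_self]
  have hrs : (1 - s * t) * s = 0 := by rw [sub_mul, mul_assoc, hts, mul_one, one_mul, sub_self]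
  rw [TwoSidedIdeal.mem_span_iff_mem_addSubgroup_closure] at ha
  induction ha using AddSubgroup.closure_induction with
  | mem y hy =>
    obtain ⟨_, ⟨c, -, _, rfl, rfl⟩, d, -, rfl⟩ := hy
    refine ⟨1, (1 - s * t) * d, c * (1 - s * t), ?_, ?_, ?_⟩
    · rw [mul_assoc, ← mul_assoc _ _ d, hr, ← mul_assoc]
    · rw [pow_one, ← mul_assoc, htr, zero_mul]
    · rw [pow_one, mul_assoc, hrs, mul_zero]
  | zero => exact ⟨0, 0, 0, by simp⟩
  | add y z _ _ hy hz =>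
    obtain ⟨n, S, T, h1, h2, h3⟩ := hy
    obtain ⟨m, S', T', h1', h2', h3'⟩ := hz
    -- Shifting the second factorization by `s ^ n` makes the cross terms vanish, because `T * s ^ n
    -- = 0` and `t ^ n * S = 0`.
    refine ⟨n + m, S + s ^ n * S', T + T' * t ^ n, ?_, ?_, ?_⟩
    · rw [add_mul, mul_add, mul_add, h1, ← mul_assoc T, h3, zero_mul, add_zero, mul_assoc T', h2,
        mul_zero, zero_add, mul_assoc T', ← mul_assoc (t ^ n), hpow, one_mul, h1']
    · rw [add_comm n m, pow_add, mul_add, mul_assoc, h2, mul_zero, zero_add, mul_assoc,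
        ← mul_assoc (t ^ n), hpow, one_mul, h2']
    · rw [pow_add, add_mul, ← mul_assoc, h3, zero_mul, zero_add, mul_assoc, ← mul_assoc (t ^ n),
        hpow, one_mul, h3']
  | neg y _ hy =>
    obtain ⟨n, S, T, h1, h2, h3⟩ := hy
    exact ⟨n, S, -T, by rw [neg_mul, h1], h2, by rw [neg_mul, h3, neg_zero]⟩

/-- An infinite idempotent of a unital ring yields a proper isometry. -/
theorem IsInfiniteIdempotent.exists_isometry {p : R} (hp : IsInfiniteIdempotent p) :
    ∃ s t : R, t * s = 1 ∧ s * t ≠ 1 := by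
  obtain ⟨hp, q, r, hq, hr, hqr, hrq, rfl, ⟨a, b, h1, h2, h3, h4⟩, hr0⟩ := hp
  have e1 := MvN.mul_left hp h1
  have e2 := MvN.mul_right hq h1
  have e3 := MvN.mul_left hq h2
  have e4 := MvN.mul_right hp h2
  have hqp : q * (q + r) = q := by rw [mul_add, hq.eq, hqr, add_zero]
  have hpq : (q + r) * q = q := by rw [add_mul, hq.eq, hrq, add_zero]
  have f1 : a * (q + r) = a := by rw [← e2, mul_assoc, hqp]
  have f2 : (q + r) * b = b := by rw [← e3, ← mul_assoc, hpq]
  generalize hP : q + r = P at *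
  -- Extend the equivalence of `P` and `q` by the identity on the complement of `P`; the range
  -- projection becomes `q + (1 - P) = 1 - r`.
  refine ⟨b + (1 - P), a + (1 - P), ?_, fun h => hr0 ?_⟩
  · simp only [add_mul, mul_add, mul_sub, sub_mul, mul_one, one_mul, f1, f2, h3, hp.eq]
    abel
  · simp only [add_mul, mul_add, mul_sub, sub_mul, mul_one, one_mul, e1, e4, h4, hp.eq] at h
    rw [← hP] at h
    have : q + r = q := by
      rw [← sub_eq_zero] at h ⊢
      rw [← neg_eq_zero, ← h]
      abel
    simpa using this

/-- For a proper isometry `s` with left inverse `t`, the defect `1 - s * t` is nonzero and so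
generates `R` as an ideal. Factoring `1 = T * S` as in `exists_factorization_of_mem_span` makes `S`
an isometry with range orthogonal to that of `s ^ n`. -/
theorem IsPurelyInfiniteSimple.exists_isometryFamily (h : IsPurelyInfiniteSimple R) :
    ∃ s t : Bool → R, IsometryFamily 1 s t := by
  obtain ⟨hsimple, hinf⟩ := h
  obtain ⟨c, d, hcd⟩ := hinf 1 one_ne_zero
  obtain ⟨s, t, hts, hst⟩ := hcd.exists_isometry
  have hmem : (1 : R) ∈ TwoSidedIdeal.span {1 - s * t} :=
    IsSimpleRing.one_mem_of_ne_zero_mem _ (sub_ne_zero.2 hst.symm)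
      (TwoSidedIdeal.subset_span rfl)
  obtain ⟨n, S, T, h1, h2, h3⟩ := exists_factorization_of_mem_span hts hmem
  refine ⟨fun i => cond i (s ^ n) S, fun i => cond i (t ^ n) T, ?_, ?_, fun _ => one_mul _,
    fun _ => mul_one _, fun _ => one_mul _, fun _ => mul_one _⟩
  · rintro (_ | _)
    · exact h1
    · exact pow_mul_pow_eq_one n hts
  · rintro (_ | _) (_ | _) hij
    · exact absurd rfl hij
    · exact h3
    · exact h2
    · exact absurd rfl hij

end
end Leavitt

/-! ### Homomorphisms out of the Leavitt path algebra -/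

namespace Leavitt

section
variable {l : Type w} [Field l] {E : DirectedGraph.{u, v}} {R : Type x} [Ring R] [Algebra l R]

/-- The homomorphism from the Leavitt path algebra to a unital algebra given by images of the
generators that satisfy the defining relations. -/
noncomputable def liftHom (φ : Gen E → R)
    (h : ∀ ⦃a b⦄, Rel l E a b → FreeAlgebra.lift l φ a = FreeAlgebra.lift l φ b) :
    LeavittPathAlgebra l E →ₙₐ[l] R :=
  ((RingQuot.liftAlgHom l ⟨FreeAlgebra.lift l φ, h⟩ :
    UnitalEnvelope l E →ₐ[l] R) : UnitalEnvelope l E →ₙₐ[l] R).comp (NonUnitalSubalgebraClass.subtype _)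

/-- A generator as an element of the Leavitt path algebra. -/
noncomputable def genMem (l : Type w) [Field l] (g : Gen E) : LeavittPathAlgebra l E :=
  ⟨gen l E g, NonUnitalAlgebra.subset_adjoin l ⟨g, rfl⟩⟩

theorem liftHom_genMem (φ : Gen E → R)
    (h : ∀ ⦃a b⦄, Rel l E a b → FreeAlgebra.lift l φ a = FreeAlgebra.lift l φ b) (g : Gen E) :
    liftHom φ h (genMem l g) = φ g := by
  change RingQuot.liftAlgHom l ⟨FreeAlgebra.lift l φ, h⟩ (RingQuot.mkAlgHom l (Rel l E) _) = _
  rw [RingQuot.liftAlgHom_mkAlgHom_apply, FreeAlgebra.lift_ι_apply]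

theorem injective_of_ne_zero {A B F : Type*} [NonUnitalRing A] [IsSimpleRing A] [NonUnitalRing B]
    [FunLike F A B] [NonUnitalRingHomClass F A B] (f : F) {a : A} (ha : f a ≠ 0) :
    Function.Injective f := by
  rw [← TwoSidedIdeal.ker_eq_bot]
  refine (eq_bot_or_eq_top _).resolve_right fun h => ha ?_
  rw [← TwoSidedIdeal.mem_ker, h]
  trivial

/-- Every edge has a source, so without vertices there are no generators at all. -/
theorem nonempty_vertex [Nontrivial (LeavittPathAlgebra l E)] : Nonempty E.Vertex := by
  by_contra hne
  rw [not_nonempty_iff] at hne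
  have : IsEmpty (Gen E) := ⟨fun g => by
    cases g with
    | vertex a => exact hne.false a
    | edge e => exact hne.false (E.source e)
    | ghost e => exact hne.false (E.source e)⟩
  have h0 : ∀ a : LeavittPathAlgebra l E, a = 0 := by
    rintro ⟨a, ha⟩
    rw [Set.range_eq_empty, NonUnitalAlgebra.adjoin_empty, NonUnitalAlgebra.mem_bot] at ha
    exact Subtype.ext ha
  obtain ⟨a, ha⟩ := exists_ne (0 : LeavittPathAlgebra l E)
  exact ha (h0 a)

/-- A nonzero idempotent `e` that is the sum of two orthogonal idempotents equivalent to `e`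
gives a homomorphism from the Leavitt path algebra of every countable graph; if there are
finitely many vertices, their images add up to `e`. -/
theorem exists_hom_of_partition [Countable E.Vertex] [Countable E.Edge] {e : R} {A B : Bool → R}
    (he : IsIdempotentElem e) (h0 : e ≠ 0) (h : IsometryFamily e A B)
    (hc : A true * B true + A false * B false = e) :
    ∃ f : LeavittPathAlgebra l E →ₙₐ[l] R, (∀ a, f (genMem l (.vertex a)) ≠ 0) ∧
      ∀ S : Finset E.Vertex, (∀ a, a ∈ S) → S.Nonempty →
        f (∑ a ∈ S, genMem l (.vertex a)) = e := by
  classical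
  obtain ⟨P, Q, hPQ, hPc⟩ := h.exists_countable hc he E.Vertex
  -- A separate family at each vertex, indexed by the edges it emits: completeness then says exactly
  -- what the relation at a regular vertex requires.
  have H := fun a : E.Vertex => h.exists_countable hc he {f : E.Edge // E.source f = a}
  choose C D hCD hCc using H
  let φ : Gen E → R := fun g => match g with
    | .vertex a => P a * Q a
    | .edge f => P (E.source f) * C _ ⟨f, rfl⟩ * Q (E.range f)
    | .ghost f => P (E.range f) * D _ ⟨f, rfl⟩ * Q (E.source f)
  have hv : ∀ a, φ (.vertex a) = P a * Q a := fun _ => rfl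
  have hf : ∀ f, φ (.edge f) = P (E.source f) * C _ ⟨f, rfl⟩ * Q (E.range f) := fun _ => rfl
  have hg : ∀ f, φ (.ghost f) = P (E.range f) * D _ ⟨f, rfl⟩ * Q (E.source f) := fun _ => rfl
  have mid : ∀ a (x z t : R), x * Q a * (P a * z * t) = x * (e * z) * t := fun a x z t => by
    rw [← hPQ.mul_self a]
    simp only [mul_assoc]
  have mid0 : ∀ a b (x z t : R), a ≠ b → x * Q a * (P b * z * t) = 0 := fun a b x z t hab => by
    rw [mul_assoc, mul_assoc (P b), ← mul_assoc (Q a), hPQ.mul_of_ne a b hab, zero_mul, mul_zero]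
  have vl : ∀ a x y, P a * Q a * (P a * x * y) = P a * x * y := fun a x y => by
    rw [mid, ← mul_assoc, hPQ.mul_left]
  have vr : ∀ a x y, x * y * Q a * (P a * Q a) = x * y * Q a := fun a x y => by
    rw [mul_assoc, ← mul_assoc (Q a), hPQ.mul_self, hPQ.right_mul]
  have hrel : ∀ ⦃a b⦄, Rel l E a b → FreeAlgebra.lift l φ a = FreeAlgebra.lift l φ b := by
    intro a b hab
    cases hab with
    | vertex_mul_self a =>
      simp only [map_mul, FreeAlgebra.lift_ι_apply, hv]
      rw [mul_assoc, ← mul_assoc (Q a), hPQ.mul_self, hPQ.right_mul]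
    | vertex_mul_of_ne a b hab =>
      simp only [map_mul, map_zero, FreeAlgebra.lift_ι_apply, hv]
      rw [mul_assoc, ← mul_assoc (Q a), hPQ.mul_of_ne a b hab, zero_mul, mul_zero]
    | source_mul_edge f =>
      simp only [map_mul, FreeAlgebra.lift_ι_apply, hv, hf, vl]
    | edge_mul_range f =>
      simp only [map_mul, FreeAlgebra.lift_ι_apply, hv, hf, vr]
    | range_mul_ghost f =>
      simp only [map_mul, FreeAlgebra.lift_ι_apply, hv, hg, vl]
    | ghost_mul_source f =>
      simp only [map_mul, FreeAlgebra.lift_ι_apply, hv, hg, vr]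
    | ghost_mul_edge_self f =>
      simp only [map_mul, FreeAlgebra.lift_ι_apply, hv, hf, hg]
      rw [mid, (hCD _).left_mul, mul_assoc (P _), (hCD _).mul_self, hPQ.mul_left]
    | ghost_mul_edge_of_ne f g hfg =>
      simp only [map_mul, map_zero, FreeAlgebra.lift_ι_apply, hf, hg]
      by_cases hs : E.source f = E.source g
      -- The sources are generalized to variables so that their equality can be substituted in the
      -- dependent indices of `C` and `D`.
      · have key : ∀ (a b : E.Vertex) (ha : E.source f = a) (hb : E.source g = b), a = b →
            P (E.range f) * D a ⟨f, ha⟩ * Q a * (P b * C b ⟨g, hb⟩ * Q (E.range g)) = 0 := by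
          rintro a _ ha hb rfl
          rw [mid, (hCD _).left_mul, mul_assoc (P _),
            (hCD _).mul_of_ne _ _ fun hh => hfg (congrArg Subtype.val hh), mul_zero, zero_mul]
        exact key _ _ rfl rfl hs
      · exact mid0 _ _ _ _ _ hs
    | regular a S hS hne =>
      simp only [map_mul, map_sum, FreeAlgebra.lift_ι_apply, hv, hf, hg]
      have key : ∀ f (hfa : E.source f = a),
          P (E.source f) * C _ ⟨f, rfl⟩ * Q (E.range f) *
            (P (E.range f) * D _ ⟨f, rfl⟩ * Q (E.source f)) =
          P a * (C a ⟨f, hfa⟩ * D a ⟨f, hfa⟩) * Q a := by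
        rintro f rfl
        rw [mid, (hCD _).right_mul]
        simp only [mul_assoc]
      rw [← Finset.sum_attach, Finset.sum_congr rfl fun f _ => key f.1 ((hS f.1).1 f.2),
        ← Finset.sum_mul, ← Finset.mul_sum]
      -- `S`, viewed inside the type of edges emitted by `a`, is all of that type.
      have hsum := hCc a (S.attach.map ⟨fun f => ⟨f.1, (hS f.1).1 f.2⟩, fun f g hfg =>
        Subtype.ext (congrArg (fun z => z.1) hfg)⟩) (fun f => by
          simp only [Finset.mem_map, Finset.mem_attach, true_and]
          exact ⟨⟨f.1, (hS _).2 f.2⟩, rfl⟩) (by simpa using hne)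
      rw [Finset.sum_map] at hsum
      exact (congrArg (fun z => P a * z * Q a) hsum).trans (by rw [hPQ.mul_left]) |>.symm
  refine ⟨liftHom φ hrel, fun a ha => h0 ?_, fun S hS hne => ?_⟩
  · rw [liftHom_genMem, hv] at ha
    have : Q a * (P a * Q a) * P a = e := by
      rw [← mul_assoc, hPQ.mul_self, hPQ.right_mul, hPQ.mul_self]
    rw [← this, ha, mul_zero, zero_mul]
  · rw [map_sum, ← hPc S hS hne]
    exact Finset.sum_congr rfl fun a _ => by rw [liftHom_genMem]

end

/-! ### The corner embedding -/

section
variable {R : Type x} [Ring R]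

/-- The embedding of `R` as the upper left corner of `M_∞ R`. -/
noncomputable def cornerHom (l : Type w) [CommRing l] (R : Type x) [Ring R] [Algebra l R] :
    R →ₙₐ[l] MInf R where
  toFun := MInf.corner
  map_smul' c a := by
    ext i j
    change (if _ then _ else _) = c • (if _ then _ else _)
    split_ifs <;> simp
  map_zero' := by
    ext i j
    simp [MInf.corner, MInf.zero_entry]
  map_add' a b := by
    ext i j
    simp only [MInf.corner, MInf.add_entry]
    split_ifs <;> simp
  map_mul' a b := by
    ext i j
    rw [MInf.mul_entry_left (n := 1)]
    · by_cases hi : i = 0 <;> by_cases hj : j = 0 <;> simp [MInf.corner, hi, hj]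
    · exact fun k hk => if_neg (by omega)

theorem MInf.corner_injective : Function.Injective (MInf.corner : R → MInf R) := fun a b h => by
  simpa [MInf.corner] using congrArg (fun A : MInf R => A.entry 0 0) h

theorem MInf.corner_mul (a b : R) : MInf.corner (a * b) = MInf.corner a * MInf.corner b :=
  map_mul (cornerHom ℤ R) a b

end
end Leavitt

/-! ### From `[1] = 0` in `K₀(R)` to a partition of the unit -/

namespace Leavitt

section
variable {R : Type x} [Ring R]

/-- The first row with entries `s 0, …, s (n - 1)`. -/
def MInf.row (n : ℕ) (s : ℕ → R) : MInf R where
  entry i j := if i = 0 ∧ j < n then s j else 0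
  finite' := ⟨n + 1, fun i j h => if_neg (by omega)⟩

/-- The first column with entries `t 0, …, t (n - 1)`. -/
def MInf.col (n : ℕ) (t : ℕ → R) : MInf R where
  entry i j := if i < n ∧ j = 0 then t i else 0
  finite' := ⟨n + 1, fun i j h => if_neg (by omega)⟩

theorem MInf.eq_corner {A : MInf R} (h : ∀ i j, i ≠ 0 ∨ j ≠ 0 → A.entry i j = 0) :
    A = MInf.corner (A.entry 0 0) := by
  ext i j
  simp only [MInf.corner]
  split_ifs with hij
  · rw [hij.1, hij.2]
  · exact h i j (by omega)

/-- If `R` contains infinitely many isometries with orthogonal ranges, every idempotent of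
`M_∞ R` is equivalent to an idempotent of `R`. -/
theorem IsometryFamily.exists_mvn_corner {s t : ℕ → R} (h : IsometryFamily 1 s t) {p : MInf R}
    (hp : IsIdempotentElem p) : ∃ q : R, IsIdempotentElem q ∧ MvN p (MInf.corner q) := by
  obtain ⟨n, hn⟩ := p.finite'
  have hSr : ∀ i j, i ≠ 0 → (MInf.row n s).entry i j = 0 := fun i j hi => if_neg (by omega)
  have hTc : ∀ i j, j ≠ 0 → (MInf.col n t).entry i j = 0 := fun i j hj => if_neg (by omega)
  -- Column times row is the unit of `M_n R`, which contains `p`; so conjugation by them compresses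
  -- `p` into the corner without loss.
  have hTS : ∀ i j, (MInf.col n t * MInf.row n s).entry i j = if i = j ∧ i < n then 1 else 0 := by
    intro i j
    rw [MInf.mul_entry_left (n := 1) _ _ _ _ fun k hk => hTc _ _ (by omega)]
    simp only [Finset.sum_range_one, MInf.col, MInf.row, and_true, true_and]
    by_cases hi : i < n <;> by_cases hj : j < n <;> by_cases hij : i = j
    all_goals first
      | (subst hij; simp [hi, h.mul_self])
      | (simp [hi, hj, hij, h.mul_of_ne i j hij])
  have hpe : p * (MInf.col n t * MInf.row n s) = p := by
    ext i j
    rw [MInf.mul_entry_left (n := n) _ _ _ _ fun k hk => hn _ _ (Or.inr hk)]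
    simp only [hTS]
    by_cases hj : j < n
    · rw [Finset.sum_eq_single_of_mem j (Finset.mem_range.2 hj) fun k _ hk => by simp [hk]]
      simp [hj]
    · rw [hn i j (Or.inr (not_lt.1 hj))]
      refine Finset.sum_eq_zero fun k hk => ?_
      rw [if_neg, mul_zero]
      rw [Finset.mem_range] at hk
      omega
  obtain ⟨S, hS⟩ : ∃ S, S = MInf.row n s := ⟨_, rfl⟩
  obtain ⟨T, hT⟩ : ∃ T, T = MInf.col n t := ⟨_, rfl⟩
  rw [← hS, ← hT] at hpe
  rw [← hS] at hSr
  rw [← hT] at hTc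
  have hpe' : ∀ z, p * (T * (S * z)) = p * z := fun z => by
    rw [← mul_assoc T, ← mul_assoc, hpe]
  have hpp : ∀ z, p * (p * z) = p * z := fun z => by rw [← mul_assoc, hp.eq]
  have hq : S * p * T = MInf.corner ((S * p * T).entry 0 0) := by
    refine MInf.eq_corner fun i j hij => ?_
    rcases hij with hi | hj
    · rw [mul_assoc, MInf.mul_entry_left (n := 0) _ _ _ _ fun k _ => hSr _ _ hi]
      simp
    · rw [MInf.mul_entry_right (n := 0) _ _ _ _ fun k _ => hTc _ _ hj]
      simp
  have hqq : IsIdempotentElem (S * p * T) := by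
    unfold IsIdempotentElem
    simp only [mul_assoc, hpe', hpp]
  refine ⟨(S * p * T).entry 0 0, MInf.corner_injective ?_, ?_⟩
  · rw [MInf.corner_mul, ← hq, hqq.eq]
  · rw [← hq]
    refine ⟨p * T, S * p, ?_, ?_, ?_, ?_⟩
    · simp only [mul_assoc, hpe', hpp]
    · simp only [mul_assoc, hpe', hp.eq]
    · simp only [mul_assoc, hpe', hp.eq]
    · simp only [mul_assoc, hpp]

theorem V.mk_corner_add {q r : R} (hq : IsIdempotentElem q) (hr : IsIdempotentElem r)
    (h : q * r = 0) (h' : r * q = 0) :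
    V.mk ⟨MInf.corner q, MInf.corner_idem hq⟩ + V.mk ⟨MInf.corner r, MInf.corner_idem hr⟩ =
      V.mk ⟨MInf.corner (q + r), MInf.corner_idem (idem_add hq hr h h')⟩ := by
  have hz : MInf.corner (0 : R) = 0 := map_zero (cornerHom ℤ R)
  rw [V.mk_add_of_orthogonal _ _ (by rw [← MInf.corner_mul, h, hz])
    (by rw [← MInf.corner_mul, h', hz])]
  exact congrArg V.mk (Subtype.ext (map_add (cornerHom ℤ R) q r).symm)

/-- If `[1] = 0` in `K₀(R)` and `R` contains infinitely many isometries with orthogonal ranges,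
then `[1] + [1] = [1]` holds already in `V(R)`. -/
theorem V.one_add_one {s t : ℕ → R} (h : IsometryFamily 1 s t) (h0 : K0.one R = 0) :
    V.mk ⟨MInf.corner (1 : R), MInf.corner_idem (mul_one 1)⟩ +
      V.mk ⟨MInf.corner (1 : R), MInf.corner_idem (mul_one 1)⟩ =
      V.mk ⟨MInf.corner (1 : R), MInf.corner_idem (mul_one 1)⟩ := by
  obtain ⟨u, hu⟩ : ∃ u : V R, u = V.mk ⟨MInf.corner (1 : R), MInf.corner_idem (mul_one 1)⟩ :=
    ⟨_, rfl⟩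
  rw [← hu]
  have h1 : Algebra.GrothendieckAddGroup.of u = Algebra.GrothendieckAddGroup.of (0 : V R) := by
    rw [map_zero, hu]
    exact h0
  -- Equality in the group completion means equality in `V(R)` after adding some `c`.
  obtain ⟨⟨c, _⟩, hc⟩ := (AddLocalization.addMonoidOf (⊤ : AddSubmonoid (V R))).eq_iff_exists.1 h1
  replace hc : c + u = c := by simpa using hc
  obtain ⟨p, rfl⟩ := c.exists_rep
  -- Realizing `c` by an idempotent `q` of `R` itself provides a complement: adding `[1 - q]` to `c
  -- + u = c` gives `u + u = u`.
  obtain ⟨q, hq, hpq⟩ := h.exists_mvn_corner p.2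
  have hq' : IsIdempotentElem (1 - q) := hq.one_sub
  have hs := V.mk_corner_add hq hq' (by rw [mul_sub, mul_one, hq.eq, sub_self])
    (by rw [sub_mul, one_mul, hq.eq, sub_self])
  have e1 : V.mk p = V.mk ⟨MInf.corner q, MInf.corner_idem hq⟩ := V.sound hpq
  have e2 : V.mk p + V.mk ⟨MInf.corner (1 - q), MInf.corner_idem hq'⟩ = u := by
    rw [e1, hs, hu]
    congr 3
    abel
  calc u + u = V.mk p + u + V.mk ⟨MInf.corner (1 - q), MInf.corner_idem hq'⟩ := by
        nth_rewrite 1 [← e2]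
        rw [add_right_comm]
    _ = u := by rw [hc, e2]

/-- The equivalence of `1 ⊕ 1` and `1` consists of a column `X` and a row `Y` of length two with `X
* Y` the unit of `M₂ R` and `Y * X = 1`. The first equation says that the entries of `Y` are
isometries with orthogonal ranges, the second that these ranges fill `1`. -/
theorem exists_partition_one_of_add_self
    (h : V.mk ⟨MInf.corner (1 : R), MInf.corner_idem (mul_one 1)⟩ +
      V.mk ⟨MInf.corner (1 : R), MInf.corner_idem (mul_one 1)⟩ =
      V.mk ⟨MInf.corner (1 : R), MInf.corner_idem (mul_one 1)⟩) :
    ∃ A B : Bool → R, IsometryFamily 1 A B ∧ A true * B true + A false * B false = 1 := by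
  obtain ⟨X, Y, h1, h2, h3, h4⟩ :
      MvN (MInf.dsum (MInf.corner (1 : R)) (MInf.corner 1)) (MInf.corner 1) := Quotient.exact h
  have hd := MInf.dsum_idem (MInf.corner_idem (mul_one (1 : R))) (MInf.corner_idem (mul_one 1))
  have hc := MInf.corner_idem (mul_one (1 : R))
  have hX := MvN.mul_right hc h1
  have hY := MvN.mul_right hd h2
  have hX' : ∀ i k, 1 ≤ k → X.entry i k = 0 := fun i k hk => by
    rw [← hX, MInf.mul_entry_right (n := 0) _ _ _ _ fun m _ => if_neg (by omega)]
    simp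
  -- The even and odd embeddings send index `0` to `0` and `1`, so this direct sum is literally the
  -- unit of `M₂ R`.
  have d (i j : ℕ) : (MInf.dsum (MInf.corner (1 : R)) (MInf.corner 1)).entry i j =
      if i = j ∧ i < 2 then 1 else 0 := by
    rw [MInf.dsum, MInf.add_entry]
    have me : ∀ i j, (MInf.move MInf.even MInf.even (MInf.corner (1 : R))).entry i j =
        if i = 0 ∧ j = 0 then 1 else 0 := by
      intro i j
      by_cases hi : ∃ a, MInf.even a = i
      · by_cases hj : ∃ b, MInf.even b = j
        · obtain ⟨a, rfl⟩ := hi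
          obtain ⟨b, rfl⟩ := hj
          rw [MInf.move_entry]
          change (if a = 0 ∧ b = 0 then (1 : R) else 0) = if 2 * a = 0 ∧ 2 * b = 0 then 1 else 0
          simp
        · rw [MInf.move_entry_col _ _ _ _ hj, if_neg]
          rintro ⟨-, rfl⟩
          exact hj ⟨0, rfl⟩
      · rw [MInf.move_entry_row _ _ _ _ hi, if_neg]
        rintro ⟨rfl, -⟩
        exact hi ⟨0, rfl⟩
    have mo : ∀ i j, (MInf.move MInf.odd MInf.odd (MInf.corner (1 : R))).entry i j =
        if i = 1 ∧ j = 1 then 1 else 0 := by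
      intro i j
      by_cases hi : ∃ a, MInf.odd a = i
      · by_cases hj : ∃ b, MInf.odd b = j
        · obtain ⟨a, rfl⟩ := hi
          obtain ⟨b, rfl⟩ := hj
          rw [MInf.move_entry]
          change (if a = 0 ∧ b = 0 then (1 : R) else 0) =
            if 2 * a + 1 = 1 ∧ 2 * b + 1 = 1 then 1 else 0
          simp
        · rw [MInf.move_entry_col _ _ _ _ hj, if_neg]
          rintro ⟨-, rfl⟩
          exact hj ⟨0, rfl⟩
      · rw [MInf.move_entry_row _ _ _ _ hi, if_neg]
        rintro ⟨rfl, -⟩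
        exact hi ⟨0, rfl⟩
    rw [me, mo]
    split_ifs <;> first | omega | simp
  have hY' : ∀ k j, 2 ≤ k → Y.entry j k = 0 := fun k j hk => by
    rw [← hY, MInf.mul_entry_right (n := 0) _ _ _ _ fun m _ => by rw [d, if_neg (by omega)]]
    simp
  have hXY : ∀ i j, X.entry i 0 * Y.entry 0 j = if i = j ∧ i < 2 then 1 else 0 := fun i j => by
    rw [← d, ← h3, MInf.mul_entry_left (n := 1) _ _ _ _ fun k hk => hX' _ _ hk,
      Finset.sum_range_one]
  refine ⟨fun b => Y.entry 0 (cond b 0 1), fun b => X.entry (cond b 0 1) 0,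
    ⟨?_, ?_, fun _ => one_mul _, fun _ => mul_one _, fun _ => one_mul _, fun _ => mul_one _⟩, ?_⟩
  · rintro (_ | _) <;> simp [hXY]
  · rintro (_ | _) (_ | _) hij <;> simp [hXY] at hij ⊢
  · have := congrArg (fun A : MInf R => A.entry 0 0) h4
    simp only [MInf.mul_entry_left (n := 2) Y X 0 0 fun k hk => hY' _ _ hk,
      Finset.sum_range_succ, Finset.sum_range_zero, zero_add, MInf.corner] at this
    simpa using this

end
end Leavitt

/-! ### The embedding theorem -/

theorem corollary3p2 (l : Type w) [Field l] (E : DirectedGraph.{u, v})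
    (hE : IsSimpleRing (Leavitt.LeavittPathAlgebra l E))
    (R : Type x) [Ring R] [Algebra l R] (hR : Leavitt.IsPurelyInfiniteSimple R) :
    (E.IsCountable →
      ∃ f : Leavitt.LeavittPathAlgebra l E →ₙₐ[l] Leavitt.MInf R, Function.Injective f) ∧
    (Finite E.Vertex → Countable E.Edge → Leavitt.K0.one R = 0 →
      ∃ f : Leavitt.LeavittPathAlgebra l E →ₙₐ[l] R, Function.Injective f ∧
        ∃ e : Leavitt.LeavittPathAlgebra l E, Leavitt.IsIdentityElem e ∧ f e = 1) ∧
    (E.IsFinite →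
      ∃ f : Leavitt.LeavittPathAlgebra l E →ₙₐ[l] R, Function.Injective f) := by
  have : IsSimpleRing R := hR.1
  obtain ⟨s, t, hst⟩ := hR.exists_isometryFamily
  obtain ⟨a⟩ := Leavitt.nonempty_vertex (l := l) (E := E)
  have main : Countable E.Vertex → Countable E.Edge →
      ∃ f : Leavitt.LeavittPathAlgebra l E →ₙₐ[l] R, Function.Injective f := by
    intro _ _
    obtain ⟨e, A, B, he, h0, h, hc⟩ := hst.exists_partition
    obtain ⟨f, hf, -⟩ := Leavitt.exists_hom_of_partition (l := l) (E := E) he h0 h hc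
    exact ⟨f, Leavitt.injective_of_ne_zero f (hf a)⟩
  refine ⟨fun hc => ?_, fun _ _ h1 => ?_, fun hf => ?_⟩
  · obtain ⟨f, hf⟩ := main hc.1 hc.2
    exact ⟨(Leavitt.cornerHom l R).comp f, Leavitt.MInf.corner_injective.comp hf⟩
  · obtain ⟨s', t', h'⟩ := hst.exists_nat
    obtain ⟨A, B, h, hc⟩ :=
      Leavitt.exists_partition_one_of_add_self (Leavitt.V.one_add_one h' h1)
    obtain ⟨f, hf, hsum⟩ := Leavitt.exists_hom_of_partition (l := l) (E := E) (mul_one (1 : R))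
      one_ne_zero h hc
    have hinj := Leavitt.injective_of_ne_zero f (hf a)
    have := Fintype.ofFinite E.Vertex
    have he := hsum Finset.univ Finset.mem_univ ⟨a, Finset.mem_univ a⟩
    -- The sum of the vertices maps to `1`, so injectivity of `f` makes it an identity of `L(E)`.
    exact ⟨f, hinj, _, fun b => ⟨hinj (by rw [map_mul, he, one_mul]),
      hinj (by rw [map_mul, he, mul_one])⟩, he⟩
  · have := hf.1
    have := hf.2
    exact main inferInstance inferInstance
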